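/- **Notation.** For a real skew-symmetric $n\times n$ matrix $\theta$ put $\theta(\mathbf s,\mathbf t)=\sum_{j,k}\theta_{jk}s_jt_k$ for $\mathbf s,\mathbf t\in\mathbb R^n$. A *$\theta$-representation* of $\mathbb R^n$ on a (complex) Hilbert space $H$ is a strongly continuous map $u:\mathbb R^n\to U(H)$ into the unitary group such that $u(\mathbf s)u(\mathbf t)=e^{\frac i2\theta(\mathbf s,\mathbf t)}u(\mathbf s+\mathbf t)$ for all $\mathbf s,\mathbf t$. For a complex Schwartz function $f\in\mathcal S(\mathbb R^n)$ let $\hat f(\mathbf s)=(2\pi)^{-n}\int_{\mathbb R^n} f(\mathbf x)e^{-i\mathbf s\cdot\mathbf x}\,d\mathbf x$, and let $u(f)=\int_{\mathbb R^n}\hat f(\mathbf s)u(\mathbf s)\,d\mathbf s$ (an integral in the strong operator topology). The Moyal product of $f,g\in\mathcal S(\mathbb R^n)$ is $$f\star_\theta g(\mathbf x)=(2\pi)^{-n}\int_{\mathbb R^n}\Big(\int_{\mathbb R^n} f(\mathbf x+\tfrac12\theta\mathbf s)\,g(\mathbf x+\mathbf t)\,e^{-i\mathbf s\cdot\mathbf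 t}\,d\mathbf t\Big)d\mathbf s ,$$ and $\lambda_\theta(f)$ denotes the bounded operator on $L_2(\mathbb R^n)$ that extends $g\mapsto f\star_\theta g$, $g\in\mathcal S(\mathbb R^n)$. Let $E_\theta\subset B(L_2(\mathbb R^n))$ be the (not necessarily unital) $C^*$-algebra generated by $\{\lambda_\theta(f): f\in\mathcal S(\mathbb R^n)\}$. A $\theta$-representation $u$ is called *canonical* if $\lambda_\theta(f)\mapsto u(f)$, $f\in\mathcal S(\mathbb R^n)$, defines a $*$-isomorphism of $E_\theta$ onto the $C^*$-algebra generated by $\{u(f): f\in\mathcal S(\mathbb R^n)\}$. **Lemma.** Let $\theta$ be a nonsingular real skew-symmetric $d\times d$ matrix, let $\hat\theta=(\theta_{jk})_{j,k=1}^{d-1}$ be its principal submatrix, and let $u:\mathbb R^d\to U(H)$ be a $\theta$-representation on a nonzero Hilbert space $H$. For $\mathbf s\in\mathbb R^{d-1}$ write $(\mathbf s,0)=(s_1,\dots,s_{d-1},0)\in\mathbb R^d$. Then $\hat u:\mathbb R^{d-1}\to U(H)$, $\hat u(\mathbf s)=u(\mathbf s,0)$, is a $\hat\theta$-representation of $\mathbb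 R^{d-1}$, each $\lambda_{\hat\theta}(f)$, $f\in\mathcal S(\mathbb R^{d-1})$, exists as a bounded operator on $L_2(\mathbb R^{d-1})$, and $\hat u$ is canonical. -/

import Mathlib

open MeasureTheory
open scoped SchwartzMap FourierTransform

/-- `ℝⁿ` with the Euclidean inner product `s · t = inner ℝ s t` and Lebesgue measure. -/
abbrev Rn (n : ℕ) : Type := EuclideanSpace ℝ (Fin n)

/-- The bilinear form `θ(s,t) = ∑ j, ∑ k, θ j k * s j * t k`. -/
def symp {n : ℕ} (θ : Matrix (Fin n) (Fin n) ℝ) (s t : Rn n) : ℝ :=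
  ∑ j, ∑ k, θ j k * s j * t k

/-- The vector `θ s`. -/
noncomputable def mulVecE {n : ℕ} (θ : Matrix (Fin n) (Fin n) ℝ) (s : Rn n) : Rn n :=
  WithLp.toLp 2 (θ.mulVec s.ofLp)

/-- The Fourier transform `(2π)⁻ⁿ ∫ f(x) exp(-i s·x) dx`, normalised so that
`f(x) = ∫ fourierHat f s * exp(i s·x) ds`. -/
noncomputable def fourierHat {n : ℕ} (f : 𝓢(Rn n, ℂ)) (s : Rn n) : ℂ :=
  (((2 * Real.pi) ^ n)⁻¹ : ℝ) * ∫ x : Rn n, f x * Complex.exp (-Complex.I * (inner ℝ s x : ℝ))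

theorem fourierHat_eq {n : ℕ} (f : 𝓢(Rn n, ℂ)) (s : Rn n) :
    fourierHat f s = (((2 * Real.pi) ^ n)⁻¹ : ℝ) * (𝓕 f) ((2 * Real.pi)⁻¹ • s) := by
  unfold fourierHat
  congr 1
  rw [SchwartzMap.fourier_coe, Real.fourier_eq']
  refine integral_congr_ae (Filter.Eventually.of_forall fun x => ?_)
  have hpi : (Real.pi : ℂ) ≠ 0 := by exact_mod_cast Real.pi_ne_zero
  simp only [smul_eq_mul, inner_smul_right]
  rw [mul_comm, real_inner_comm]
  congr 2
  push_cast
  field_simp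

theorem integrable_fourierHat {n : ℕ} (f : 𝓢(Rn n, ℂ)) : Integrable (fourierHat f) := by
  have h : Integrable (fun s : Rn n => (𝓕 f) ((2 * Real.pi)⁻¹ • s)) :=
    (SchwartzMap.integrable (𝓕 f)).comp_smul (inv_ne_zero (by positivity))
  have h2 : fourierHat f =
      fun s : Rn n => ((((2 * Real.pi) ^ n)⁻¹ : ℝ) : ℂ) * (𝓕 f) ((2 * Real.pi)⁻¹ • s) :=
    funext (fourierHat_eq f)
  rw [h2]
  exact h.const_mul _

/-- The Moyal product
`(f ⋆_θ g)(x) = (2π)⁻ⁿ ∫∫ f(x + θs/2) g(x + t) exp(-i s·t) dt ds`.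
The integral over `t` is the inner one; in this order both integrals converge absolutely
for every `θ`, singular or not. -/
noncomputable def moyal {n : ℕ} (θ : Matrix (Fin n) (Fin n) ℝ) (f g : 𝓢(Rn n, ℂ))
    (x : Rn n) : ℂ :=
  (((2 * Real.pi) ^ n)⁻¹ : ℝ) *
    ∫ s : Rn n, ∫ t : Rn n,
      f (x + (1 / 2 : ℝ) • mulVecE θ s) * g (x + t) * Complex.exp (-Complex.I * (inner ℝ s t : ℝ))

/-- `L₂(ℝⁿ)`. -/
abbrev L2Rn (n : ℕ) : Type := Lp ℂ 2 (volume : Measure (Rn n))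

/-- `T = λ_θ(f)`: the bounded operator `T` on `L₂(ℝⁿ)` is left Moyal multiplication by `f`,
i.e. `T g = f ⋆_θ g` for all `g` in the dense subspace of Schwartz functions. -/
def IsLeftMoyal {n : ℕ} (θ : Matrix (Fin n) (Fin n) ℝ) (f : 𝓢(Rn n, ℂ))
    (T : L2Rn n →L[ℂ] L2Rn n) : Prop :=
  ∀ g : 𝓢(Rn n, ℂ), (T (g.toLp 2 volume) : Rn n → ℂ) =ᵐ[volume] moyal θ f g

/-- The (not necessarily unital) `C⋆`-algebra of operators generated by a set `S`. -/
noncomputable def cstarGen {K : Type*} [NormedAddCommGroup K] [InnerProductSpace ℂ K]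
    [CompleteSpace K] (S : Set (K →L[ℂ] K)) : NonUnitalStarSubalgebra ℂ (K →L[ℂ] K) :=
  (NonUnitalStarAlgebra.adjoin ℂ S).topologicalClosure

/-- The noncommutative Euclidean space `E_θ`: the `C⋆`-algebra generated by the operators
`λ_θ(f)`, `f` a Schwartz function. -/
noncomputable def Etheta {n : ℕ} (θ : Matrix (Fin n) (Fin n) ℝ) :
    NonUnitalStarSubalgebra ℂ (L2Rn n →L[ℂ] L2Rn n) :=
  cstarGen {T | ∃ f : 𝓢(Rn n, ℂ), IsLeftMoyal θ f T}

section Representations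

variable {H : Type*} [NormedAddCommGroup H] [InnerProductSpace ℂ H] [CompleteSpace H]

/-- `u` is a `θ`-projective unitary representation of `ℝⁿ` on `H`. -/
structure IsThetaRep {n : ℕ} (θ : Matrix (Fin n) (Fin n) ℝ)
    (u : Rn n → unitary (H →L[ℂ] H)) : Prop where
  continuous_apply : ∀ ξ : H, Continuous fun s => (u s : H →L[ℂ] H) ξ
  mul_eq : ∀ s t : Rn n, (u s : H →L[ℂ] H) * (u t : H →L[ℂ] H) =
    Complex.exp (Complex.I / 2 * (symp θ s t : ℝ)) • (u (s + t) : H →L[ℂ] H)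

theorem norm_unitary_apply (v : unitary (H →L[ℂ] H)) (ξ : H) :
    ‖(v : H →L[ℂ] H) ξ‖ = ‖ξ‖ :=
  (ContinuousLinearMap.norm_map_iff_adjoint_comp_self (v : H →L[ℂ] H)).2
    (Unitary.star_mul_self_of_mem v.2) ξ

theorem IsThetaRep.integrable {n : ℕ} {θ : Matrix (Fin n) (Fin n) ℝ}
    {u : Rn n → unitary (H →L[ℂ] H)} (hu : IsThetaRep θ u) (f : 𝓢(Rn n, ℂ)) (ξ : H) :
    Integrable fun s => fourierHat f s • (u s : H →L[ℂ] H) ξ := by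
  refine Integrable.mono' ((integrable_fourierHat f).norm.mul_const ‖ξ‖)
    ((integrable_fourierHat f).aestronglyMeasurable.smul
      (hu.continuous_apply ξ).aestronglyMeasurable) ?_
  refine Filter.Eventually.of_forall fun s => ?_
  rw [norm_smul, norm_unitary_apply]

/-- The quantization map `u(f) = ∫ f̂(s) u(s) ds`, the integral taken in the strong operator
topology: `u(f) ξ = ∫ f̂(s) u(s) ξ ds`. -/
noncomputable def IsThetaRep.quantize {n : ℕ} {θ : Matrix (Fin n) (Fin n) ℝ}
    {u : Rn n → unitary (H →L[ℂ] H)} (hu : IsThetaRep θ u) (f : 𝓢(Rn n, ℂ)) : H →L[ℂ] H :=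
  LinearMap.mkContinuous
    { toFun := fun ξ => ∫ s : Rn n, fourierHat f s • (u s : H →L[ℂ] H) ξ
      map_add' := fun ξ η => by
        simp only [map_add, smul_add]
        exact integral_add (hu.integrable f ξ) (hu.integrable f η)
      map_smul' := fun c ξ => by
        simp only [map_smul, RingHom.id_apply]
        rw [← integral_smul]
        simp only [smul_comm c] }
    (∫ s : Rn n, ‖fourierHat f s‖)
    (fun ξ => by
      rw [← integral_mul_const]
      refine (norm_integral_le_integral_norm _).trans (le_of_eq ?_)
      refine integral_congr_ae (Filter.Eventually.of_forall fun s => ?_)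
      simp only [norm_smul, norm_unitary_apply])

/-- The `C⋆`-algebra generated by the operators `u(f)`, `f` a Schwartz function. -/
noncomputable def IsThetaRep.cstar {n : ℕ} {θ : Matrix (Fin n) (Fin n) ℝ}
    {u : Rn n → unitary (H →L[ℂ] H)} (hu : IsThetaRep θ u) :
    NonUnitalStarSubalgebra ℂ (H →L[ℂ] H) :=
  cstarGen (Set.range hu.quantize)

/-- `u` is canonical: every `λ_θ(f)` exists as a bounded operator on `L₂(ℝⁿ)`, and
`λ_θ(f) ↦ u(f)` defines a `⋆`-isomorphism of `E_θ` onto the `C⋆`-algebra generated by the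
`u(f)`. -/
def IsThetaRep.IsCanonical {n : ℕ} {θ : Matrix (Fin n) (Fin n) ℝ}
    {u : Rn n → unitary (H →L[ℂ] H)} (hu : IsThetaRep θ u) : Prop :=
  (∀ f : 𝓢(Rn n, ℂ), ∃ T : L2Rn n →L[ℂ] L2Rn n, IsLeftMoyal θ f T) ∧
  ∃ π : Etheta θ ≃⋆ₐ[ℂ] hu.cstar,
    ∀ (f : 𝓢(Rn n, ℂ)) (T : Etheta θ),
      IsLeftMoyal θ f (T : L2Rn n →L[ℂ] L2Rn n) → (π T : H →L[ℂ] H) = hu.quantize f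

end Representations

/-- `(s, 0) = (s₁, …, sₙ, 0)`. -/
noncomputable def appendZero {n : ℕ} (s : Rn n) : Rn (n + 1) :=
  WithLp.toLp 2 (Fin.snoc (α := fun _ => ℝ) s.ofLp 0)

/-- The principal submatrix obtained by deleting the last row and the last column. -/
def hatMatrix {n : ℕ} (θ : Matrix (Fin (n + 1)) (Fin (n + 1)) ℝ) :
    Matrix (Fin n) (Fin n) ℝ :=
  θ.submatrix Fin.castSucc Fin.castSucc

/-! The principal submatrix of `θ` may be singular, but `θ` itself is not, so conjugation by the
unitaries `V x = u (θ⁻¹ (x, 0))` multiplies the restricted representation by an arbitrary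
character `s ↦ exp(i s·x)` of `ℝⁿ`. Any `θ`-representation `u` on `H ≠ 0` with such a strongly
continuous family `V` is canonical (`IsThetaRep.isCanonical`); this is an absorption principle in
the manner of Fell, and no uniqueness theorem for representations is needed.

For `ξ ∈ H` consider `J_ξ : L₂(ℝⁿ) → L₂(ℝⁿ; H)`, sending a Schwartz function `g` to
`x ↦ u(g) V(x) ξ` (`IsThetaRep.intertwiner`). Moving `V(x)` to the left turns `u(g) V(x) ξ` into
`V(x)` applied to the inverse Fourier transform at `x` of `t ↦ 𝓕 g(t) u(2πt) ξ`, so Plancherel's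
theorem for `H`-valued functions gives `‖J_ξ g‖ = ‖ξ‖ ‖g‖` (`IsThetaRep.norm_intertwiner`).
Since `u(f) u(g)` is the integral of `u` against the twisted convolution of `𝓕 f` and `𝓕 g`, whose
inverse Fourier transform is `f ⋆_θ g`, the operator `J_ξ` carries Moyal multiplication by `f` to
`1 ⊗ u(f)` (`IsThetaRep.exists_intertwiner_moyal`). In particular `J_ξ⋆ (1 ⊗ u(f)) J_ξ` with
`‖ξ‖ = 1` is a bounded operator `λ_θ(f)`.

The pairs `(x, y)` such that all `J_ξ` carry `x` to `1 ⊗ y` and `x⋆` to `1 ⊗ y⋆` form a closed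
`⋆`-algebra (`IsThetaRep.intertwinedPairs`) containing every `(λ_θ(f), u(f))`. In such a pair
`x = 0` if and only if `y = 0`: one direction because `J_ξ` is isometric for a unit vector `ξ`, the
other because the vectors `u(g) η` are total in `H`. So both coordinate projections are injective
on this `C⋆`-algebra, hence isometric, and the `C⋆`-algebra generated by the pairs
`(λ_θ(f), u(f))` is the graph of the required isomorphism (`exists_starAlgEquiv_of_graph`). -/

/-! ### Isomorphisms of `C⋆`-algebras from their graphs -/

section CStar

variable {A B : Type*} [NonUnitalCStarAlgebra A] [NonUnitalCStarAlgebra B]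

/-- An injective `⋆`-homomorphism is isometric; here it is the first projection on `R`. -/
theorem norm_fst_eq_norm_of_mem (R : NonUnitalStarSubalgebra ℂ (A × B))
    (hRc : IsClosed (R : Set (A × B))) (hR : ∀ p ∈ R, p.1 = 0 → p.2 = 0) {p : A × B}
    (hp : p ∈ R) : ‖p.1‖ = ‖p‖ := by
  have : IsClosed (R : Set (A × B)) := hRc
  let φ : R →⋆ₙₐ[ℂ] A :=
    (NonUnitalStarAlgHom.fst ℂ A B).comp (NonUnitalStarSubalgebraClass.subtype R)
  refine NonUnitalStarAlgHom.norm_map φ ?_ ⟨p, hp⟩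
  rw [injective_iff_map_eq_zero]
  rintro ⟨q, hq⟩ h0
  exact Subtype.ext (Prod.ext h0 (hR q hq h0))

theorem norm_snd_eq_norm_of_mem (R : NonUnitalStarSubalgebra ℂ (A × B))
    (hRc : IsClosed (R : Set (A × B))) (hR : ∀ p ∈ R, p.2 = 0 → p.1 = 0) {p : A × B}
    (hp : p ∈ R) : ‖p.2‖ = ‖p‖ := by
  have : IsClosed (R : Set (A × B)) := hRc
  let φ : R →⋆ₙₐ[ℂ] B :=
    (NonUnitalStarAlgHom.snd ℂ A B).comp (NonUnitalStarSubalgebraClass.subtype R)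
  refine NonUnitalStarAlgHom.norm_map φ ?_ ⟨p, hp⟩
  rw [injective_iff_map_eq_zero]
  rintro ⟨q, hq⟩ h0
  exact Subtype.ext (Prod.ext (hR q hq h0) h0)

/-- A `⋆`-homomorphism that is isometric on the `C⋆`-algebra generated by `S` maps it
isomorphically onto the `C⋆`-algebra generated by the image of `S`. -/
theorem exists_starAlgEquiv_of_isometry (φ : A →⋆ₙₐ[ℂ] B) (S : Set A) (T : Set B)
    (hT : φ '' S = T) (hφ : Continuous φ)
    (h : ∀ x ∈ (NonUnitalStarAlgebra.adjoin ℂ S).topologicalClosure, ‖φ x‖ = ‖x‖) :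
    ∃ e : (NonUnitalStarAlgebra.adjoin ℂ S).topologicalClosure ≃⋆ₐ[ℂ]
      (NonUnitalStarAlgebra.adjoin ℂ T).topologicalClosure,
      ∀ x, (e x : B) = φ x := by
  subst hT
  set 𝒢 := (NonUnitalStarAlgebra.adjoin ℂ S).topologicalClosure
  set ψ : 𝒢 →⋆ₙₐ[ℂ] B := φ.comp (NonUnitalStarSubalgebraClass.subtype 𝒢)
  have hψ : Isometry ψ := AddMonoidHomClass.isometry_of_norm ψ fun x => h x x.2
  have hcl : IsClosed (𝒢 : Set A) := NonUnitalStarSubalgebra.isClosed_topologicalClosure _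
  have : CompleteSpace 𝒢 := hcl.completeSpace_coe
  have hrange : Set.range ψ = φ '' (𝒢 : Set A) := by
    ext y; simp [ψ]
  have himage : φ '' (𝒢 : Set A) = closure (φ '' (NonUnitalStarAlgebra.adjoin ℂ S : Set A)) := by
    refine (image_closure_subset_closure_image hφ).antisymm ?_
    refine closure_minimal (Set.image_mono (NonUnitalStarSubalgebra.le_topologicalClosure _)) ?_
    have := hψ.isClosedEmbedding.isClosed_range
    rwa [hrange] at this
  have hset : Set.range ψ =
      ((NonUnitalStarAlgebra.adjoin ℂ (φ '' S)).topologicalClosure : Set B) := by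
    rw [hrange, himage, ← NonUnitalStarSubalgebra.coe_map, NonUnitalStarAlgHom.map_adjoin]
    rfl
  have hmem : ∀ x, ψ x ∈ (NonUnitalStarAlgebra.adjoin ℂ (φ '' S)).topologicalClosure := fun x => by
    rw [← SetLike.mem_coe, ← hset]; exact ⟨x, rfl⟩
  refine ⟨StarAlgEquiv.ofBijective (NonUnitalStarAlgHom.codRestrict ψ _ hmem) ⟨?_, ?_⟩,
    fun x => rfl⟩
  · exact (NonUnitalStarAlgHom.injective_codRestrict _ _ _).2 hψ.injective
  · rintro ⟨y, hy⟩
    rw [← SetLike.mem_coe, ← hset] at hy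
    obtain ⟨x, rfl⟩ := hy
    exact ⟨x, rfl⟩

/-- If a closed `⋆`-subalgebra of `A × B` contains all pairs `(a i, b i)` and is the graph of an
injective map, then `a i ↦ b i` defines a `⋆`-isomorphism of the generated `C⋆`-algebras. -/
theorem exists_starAlgEquiv_of_graph {ι : Type*} (a : ι → A) (b : ι → B)
    {S : Set A} {T : Set B} (hS : Set.range a = S) (hT : Set.range b = T)
    (R : NonUnitalStarSubalgebra ℂ (A × B)) (hRc : IsClosed (R : Set (A × B)))
    (hab : ∀ i, (a i, b i) ∈ R) (hR : ∀ p ∈ R, p.1 = 0 ↔ p.2 = 0) :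
    ∃ e : (NonUnitalStarAlgebra.adjoin ℂ S).topologicalClosure ≃⋆ₐ[ℂ]
      (NonUnitalStarAlgebra.adjoin ℂ T).topologicalClosure,
      ∀ (i : ι) (x : (NonUnitalStarAlgebra.adjoin ℂ S).topologicalClosure),
        (x : A) = a i → (e x : B) = b i := by
  subst hS hT
  set S : Set (A × B) := Set.range fun i => (a i, b i)
  have hle : (NonUnitalStarAlgebra.adjoin ℂ S).topologicalClosure ≤ R := by
    refine NonUnitalStarSubalgebra.topologicalClosure_minimal _ ?_ hRc
    refine NonUnitalStarAlgebra.adjoin_le ?_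
    rintro _ ⟨i, rfl⟩
    exact hab i
  obtain ⟨e₁, he₁⟩ := exists_starAlgEquiv_of_isometry (NonUnitalStarAlgHom.fst ℂ A B) S
    (Set.range a) (by rw [← Set.range_comp]; rfl) continuous_fst
    fun p hp => norm_fst_eq_norm_of_mem R hRc (fun p hp => (hR p hp).1) (hle hp)
  obtain ⟨e₂, he₂⟩ := exists_starAlgEquiv_of_isometry (NonUnitalStarAlgHom.snd ℂ A B) S
    (Set.range b) (by rw [← Set.range_comp]; rfl) continuous_snd
    fun p hp => norm_snd_eq_norm_of_mem R hRc (fun p hp => (hR p hp).2) (hle hp)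
  refine ⟨e₁.symm.trans e₂, fun i x hx => ?_⟩
  let p : (NonUnitalStarAlgebra.adjoin ℂ S).topologicalClosure :=
    ⟨(a i, b i), NonUnitalStarSubalgebra.le_topologicalClosure _
      (NonUnitalStarAlgebra.subset_adjoin ℂ S ⟨i, rfl⟩)⟩
  have hp : e₁ p = x := Subtype.ext ((he₁ p).trans hx.symm)
  rw [← hp, StarAlgEquiv.trans_apply, StarAlgEquiv.symm_apply_apply]
  exact he₂ p

end CStar

/-! ### Multiplication by strongly continuous operator fields -/

section FieldMul

variable {X E F : Type*} [NormedAddCommGroup E] [NormedSpace ℂ E]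
  [NormedAddCommGroup F] [NormedSpace ℂ F]

/-- A strongly continuous field of operators on `X`, each of which multiplies norms by `c`. -/
structure IsHomothetyField [TopologicalSpace X] (A : X → E →L[ℂ] F) (c : ℝ) : Prop where
  continuous_apply : ∀ e, Continuous fun x => A x e
  norm_apply : ∀ x e, ‖A x e‖ = c * ‖e‖
  nonneg : 0 ≤ c

theorem IsHomothetyField.continuous_uncurry [TopologicalSpace X] {A : X → E →L[ℂ] F} {c : ℝ}
    (hA : IsHomothetyField A c) : Continuous fun p : X × E => A p.1 p.2 := by
  refine continuous_prod_of_continuous_lipschitzWith' _ ⟨c, hA.nonneg⟩ (fun x => ?_)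
    hA.continuous_apply
  refine LipschitzWith.of_dist_le_mul fun e e' => ?_
  rw [dist_eq_norm, dist_eq_norm, ← map_sub]
  exact (hA.norm_apply x _).le

variable {n : ℕ} {A : Rn n → E →L[ℂ] F} {c : ℝ}

theorem IsHomothetyField.aestronglyMeasurable (hA : IsHomothetyField A c) {h : Rn n → E}
    (hh : AEStronglyMeasurable h volume) : AEStronglyMeasurable (fun x => A x (h x)) volume :=
  hA.continuous_uncurry.comp_aestronglyMeasurable
    (f := fun x => (x, h x)) (aestronglyMeasurable_id.prodMk hh)

theorem IsHomothetyField.memLp (hA : IsHomothetyField A c) {h : Rn n → E}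
    (hh : MemLp h 2) : MemLp (fun x => A x (h x)) 2 :=
  hh.of_le_mul (c := c) (hA.aestronglyMeasurable hh.1)
    (Filter.Eventually.of_forall fun x => (hA.norm_apply x _).le)

theorem IsHomothetyField.norm_toLp (hA : IsHomothetyField A c)
    (h : Lp E 2 (volume : Measure (Rn n))) :
    ‖(hA.memLp (Lp.memLp h)).toLp _‖ = c * ‖h‖ := by
  have h1 : ‖(hA.memLp (Lp.memLp h)).toLp _‖ = ‖(c : ℂ) • h‖ := by
    rw [Lp.norm_def, Lp.norm_def]
    congr 1
    refine eLpNorm_congr_norm_ae ?_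
    filter_upwards [(hA.memLp (Lp.memLp h)).coeFn_toLp, Lp.coeFn_smul (c : ℂ) h] with x h1 h2
    rw [h1, h2, hA.norm_apply, Pi.smul_apply, norm_smul, Complex.norm_real,
      Real.norm_of_nonneg hA.nonneg]
  rw [h1, norm_smul, Complex.norm_real, Real.norm_of_nonneg hA.nonneg]

/-- Pointwise application of a homothety field, as an operator between `L²` spaces. -/
noncomputable def IsHomothetyField.mulLp (hA : IsHomothetyField A c) :
    Lp E 2 (volume : Measure (Rn n)) →L[ℂ] Lp F 2 (volume : Measure (Rn n)) :=
  LinearMap.mkContinuous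
    { toFun := fun h => (hA.memLp (Lp.memLp h)).toLp _
      map_add' := fun h k => by
        rw [← MemLp.toLp_add]
        refine MemLp.toLp_congr _ _ ?_
        filter_upwards [Lp.coeFn_add h k] with x hx
        rw [hx, Pi.add_apply, map_add, Pi.add_apply]
      map_smul' := fun a h => by
        rw [RingHom.id_apply, ← MemLp.toLp_const_smul]
        refine MemLp.toLp_congr _ _ ?_
        filter_upwards [Lp.coeFn_smul a h] with x hx
        rw [hx, Pi.smul_apply, map_smul, Pi.smul_apply] } c (fun h => (hA.norm_toLp h).le)

theorem IsHomothetyField.coeFn_mulLp (hA : IsHomothetyField A c)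
    (h : Lp E 2 (volume : Measure (Rn n))) : hA.mulLp h =ᵐ[volume] fun x => A x (h x) :=
  (hA.memLp (Lp.memLp h)).coeFn_toLp

theorem IsHomothetyField.norm_mulLp (hA : IsHomothetyField A c)
    (h : Lp E 2 (volume : Measure (Rn n))) : ‖hA.mulLp h‖ = c * ‖h‖ :=
  hA.norm_toLp h

end FieldMul

/-! ### The Fourier transform on `L¹ ∩ L²` -/

section Fourier

variable {n : ℕ} {F : Type*} [NormedAddCommGroup F] [InnerProductSpace ℂ F] [CompleteSpace F]

/-- For `h ∈ L¹ ∩ L²` the inverse Fourier transform on `L²` is given by the absolutely convergent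
Fourier integral. -/
theorem coeFn_fourierInv_toLp {h : Rn n → F} (h1 : Integrable h) (h2 : MemLp h 2) :
    (𝓕⁻ (h2.toLp h) : Lp F 2 (volume : Measure (Rn n))) =ᵐ[volume] 𝓕⁻ h := by
  have hL : Continuous fun p : Rn n × Rn n => (-innerₗ (Rn n)) p.1 p.2 := by
    simp only [LinearMap.neg_apply, innerₗ_apply_apply]
    fun_prop
  have hcont : Continuous (𝓕⁻ h) :=
    VectorFourier.fourierIntegral_continuous Real.continuous_fourierChar hL h1
  -- Both sides are tested against smooth compactly supported functions: the left one through
  -- its tempered distribution, the right one by self-adjointness of the Fourier integral.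
  refine ae_eq_of_integral_contDiff_smul_eq
    ((Lp.memLp _).locallyIntegrable one_le_two) hcont.locallyIntegrable fun g gs gc => ?_
  have hg₁ : HasCompactSupport (Complex.ofRealCLM ∘ g) := gc.comp_left rfl
  have hg₂ : ContDiff ℝ (⊤ : ℕ∞) (Complex.ofRealCLM ∘ g) := by fun_prop
  set φ : 𝓢(Rn n, ℂ) := hg₁.toSchwartzMap hg₂
  have hφ : ∀ x, φ x = (g x : ℂ) := fun x => rfl
  have key := congrArg (fun T => T φ) (Lp.fourierInv_toTemperedDistribution_eq (h2.toLp h))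
  simp only [TemperedDistribution.fourierInv_apply, Lp.toTemperedDistribution_apply] at key
  have e1 : ∫ x, g x • (𝓕⁻ (h2.toLp h) : Lp F 2 (volume : Measure (Rn n))) x
      = ∫ x, φ x • (𝓕⁻ (h2.toLp h) : Lp F 2 (volume : Measure (Rn n))) x := by
    simp [hφ]
  rw [e1, ← key]
  have e2 : ∫ x, (𝓕⁻ φ) x • (h2.toLp h) x = ∫ x, (𝓕⁻ (φ : Rn n → ℂ)) x • h x := by
    refine integral_congr_ae ?_
    filter_upwards [h2.coeFn_toLp] with x hx
    rw [hx, SchwartzMap.fourierInv_coe]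
  have hflip : (-innerₗ (Rn n)).flip = -innerₗ (Rn n) := by
    ext x y; simp [real_inner_comm]
  have e3 := VectorFourier.integral_fourierIntegral_smul_eq_flip (μ := volume) (ν := volume)
    (L := -innerₗ (Rn n)) Real.continuous_fourierChar hL φ.integrable h1
  rw [hflip] at e3
  rw [e2]
  refine e3.trans ?_
  simp only [hφ, Complex.coe_smul]
  rfl

end Fourier

/-! ### The bilinear form of `θ` -/

section Symp

variable {n : ℕ} (θ : Matrix (Fin n) (Fin n) ℝ)

theorem symp_eq_inner (s t : Rn n) : symp θ s t = inner ℝ s (mulVecE θ t) := by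
  simp only [symp, mulVecE, PiLp.inner_apply, Matrix.mulVec, dotProduct, RCLike.inner_apply,
    conj_trivial, Finset.sum_mul]
  refine Finset.sum_congr rfl fun j _ => Finset.sum_congr rfl fun k _ => ?_
  ring

theorem continuous_mulVecE : Continuous (mulVecE θ) := by
  unfold mulVecE
  exact (PiLp.continuous_toLp 2 _).comp
    (Continuous.matrix_mulVec continuous_const (PiLp.continuous_ofLp 2 _))

theorem mulVecE_neg (t : Rn n) : mulVecE θ (-t) = -mulVecE θ t := by
  simp [mulVecE, Matrix.mulVec_neg]

theorem symp_neg_right (s t : Rn n) : symp θ s (-t) = -symp θ s t := by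
  rw [symp_eq_inner, symp_eq_inner, mulVecE_neg, inner_neg_right]

theorem symp_swap {θ : Matrix (Fin n) (Fin n) ℝ} (hθ : θ.transpose = -θ) (s t : Rn n) :
    symp θ s t = -symp θ t s := by
  unfold symp
  rw [Finset.sum_comm, ← Finset.sum_neg_distrib]
  refine Finset.sum_congr rfl fun j _ => ?_
  rw [← Finset.sum_neg_distrib]
  refine Finset.sum_congr rfl fun k _ => ?_
  have : θ k j = - θ j k := congrFun (congrFun hθ j) k
  rw [this]; ring

theorem symp_self {θ : Matrix (Fin n) (Fin n) ℝ} (hθ : θ.transpose = -θ) (s : Rn n) :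
    symp θ s s = 0 := by
  have := symp_swap hθ s s
  linarith

theorem norm_exp_half (r : ℝ) : ‖Complex.exp (Complex.I / 2 * (r : ℂ))‖ = 1 := by
  rw [show Complex.I / 2 * (r : ℂ) = ((r / 2 : ℝ) : ℂ) * Complex.I by push_cast; ring,
    Complex.norm_exp_ofReal_mul_I]

end Symp

/-! ### Twisted convolution -/

section Twist

variable {n : ℕ} (θ : Matrix (Fin n) (Fin n) ℝ) (f g : 𝓢(Rn n, ℂ))

/-- The kernel of the twisted convolution of `𝓕 f` and `𝓕 g`, in the variables `s` and `r` whose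
sum is the argument of the convolution. -/
noncomputable def twistKernel (s r : Rn n) : ℂ :=
  𝓕 f s * 𝓕 g r * Complex.exp (Complex.I / 2 *
    (symp θ ((2 * Real.pi) • s) ((2 * Real.pi) • r) : ℝ))

/-- The twisted convolution of `𝓕 f` and `𝓕 g`. -/
noncomputable def twistConv (t : Rn n) : ℂ := ∫ s, twistKernel θ f g s (t - s)

theorem continuous_twistKernel : Continuous fun p : Rn n × Rn n => twistKernel θ f g p.1 p.2 := by
  unfold twistKernel
  have h1 : Continuous fun p : Rn n × Rn n =>
      symp θ ((2 * Real.pi) • p.1) ((2 * Real.pi) • p.2) := by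
    simp only [symp_eq_inner]
    have := continuous_mulVecE θ
    fun_prop
  have h2 := (𝓕 f).continuous
  have h3 := (𝓕 g).continuous
  fun_prop

theorem norm_twistKernel (s r : Rn n) : ‖twistKernel θ f g s r‖ = ‖𝓕 f s‖ * ‖𝓕 g r‖ := by
  rw [twistKernel, norm_mul, norm_mul, norm_exp_half, mul_one]

theorem integrable_twistKernel :
    Integrable (fun p : Rn n × Rn n => twistKernel θ f g p.1 p.2) (volume.prod volume) := by
  refine ((𝓕 f).integrable.norm.mul_prod (𝓕 g).integrable.norm).mono'
    (continuous_twistKernel θ f g).aestronglyMeasurable (Filter.Eventually.of_forall fun p => ?_)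
  exact (norm_twistKernel θ f g p.1 p.2).le

theorem integrable_twistKernel_sub :
    Integrable (fun p : Rn n × Rn n => twistKernel θ f g p.2 (p.1 - p.2))
      (volume.prod volume) := by
  refine (((𝓕 f).integrable.norm.convolution_integrand (ContinuousLinearMap.mul ℝ ℝ)
    (𝓕 g).integrable.norm)).mono' ?_ (Filter.Eventually.of_forall fun p => ?_)
  · exact ((continuous_twistKernel θ f g).comp
      (continuous_snd.prodMk (continuous_fst.sub continuous_snd))).aestronglyMeasurable
  · exact (norm_twistKernel θ f g _ _).le

theorem integrable_twistConv : Integrable (twistConv θ f g) :=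
  (integrable_twistKernel_sub θ f g).integral_prod_left

theorem memLp_twistConv : MemLp (twistConv θ f g) 2 := by
  obtain ⟨C, hC⟩ : ∃ C, ∀ x, ‖𝓕 g x‖ ≤ C :=
    ⟨_, fun x => (𝓕 g).toBoundedContinuousFunction.norm_coe_le_norm x⟩
  have hb : ∀ t, ‖twistConv θ f g t‖ ≤ ∫ s, ‖𝓕 f s‖ * C := fun t => by
    refine norm_integral_le_of_norm_le ((𝓕 f).integrable.norm.mul_const C)
      (Filter.Eventually.of_forall fun s => ?_)
    rw [norm_twistKernel]
    exact mul_le_mul_of_nonneg_left (hC _) (norm_nonneg _)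
  have hi := integrable_twistConv θ f g
  rw [memLp_two_iff_integrable_sq_norm hi.1]
  refine (hi.norm.const_mul (∫ s, ‖𝓕 f s‖ * C)).mono' (hi.1.norm.pow 2)
    (Filter.Eventually.of_forall fun t => ?_)
  rw [Real.norm_of_nonneg (by positivity), pow_two]
  exact mul_le_mul_of_nonneg_right (hb t) (norm_nonneg _)

variable {F : Type*} [NormedAddCommGroup F] [NormedSpace ℂ F]

/-- Integrals against the twisted convolution unfold to double integrals against its kernel. For
`Y` the orbit of a vector this computes products of quantizations, for `Y` a character the inverse
Fourier transform. -/
theorem integral_twistConv_smul [CompleteSpace F] {Y : Rn n → F} (hY : Continuous Y) {C : ℝ}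
    (hC : ∀ t, ‖Y t‖ ≤ C) :
    ∫ t, twistConv θ f g t • Y t = ∫ s, ∫ r, twistKernel θ f g s r • Y (s + r) := by
  have h1 : ∀ t, twistConv θ f g t • Y t = ∫ s, twistKernel θ f g s (t - s) • Y t := fun t =>
    (integral_smul_const _ _).symm
  simp only [h1]
  have hint : Integrable (fun p : Rn n × Rn n => twistKernel θ f g p.2 (p.1 - p.2) • Y p.1)
      (volume.prod volume) := by
    refine ((integrable_twistKernel_sub θ f g).norm.mul_const C).mono'
      ((integrable_twistKernel_sub θ f g).1.smul
        (hY.comp continuous_fst).aestronglyMeasurable) (Filter.Eventually.of_forall fun p => ?_)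
    rw [norm_smul]
    exact mul_le_mul_of_nonneg_left (hC _) (norm_nonneg _)
  rw [integral_integral_swap hint]
  refine integral_congr_ae (Filter.Eventually.of_forall fun s => ?_)
  dsimp only
  rw [← integral_add_left_eq_self _ s]
  simp only [add_sub_cancel_left]

end Twist

/-! ### The Moyal product as a Fourier transform -/

section Moyal

variable {n : ℕ} (θ : Matrix (Fin n) (Fin n) ℝ) (f g : 𝓢(Rn n, ℂ))

theorem integral_comp_two_pi_smul {F : Type*} [NormedAddCommGroup F] [NormedSpace ℝ F]
    (Φ : Rn n → F) : ∫ r, Φ ((2 * Real.pi) • r) = ((2 * Real.pi) ^ n)⁻¹ • ∫ s, Φ s := by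
  rw [Measure.integral_comp_smul, finrank_euclideanSpace_fin,
    abs_of_pos (by positivity)]

theorem schwartz_fourier_inversion (x : Rn n) :
    f x = ∫ s, 𝓕 f s * Complex.exp (Complex.I * ((inner ℝ ((2 * Real.pi) • s) x : ℝ) : ℂ)) := by
  conv_lhs => rw [← FourierTransform.fourierInv_fourier_eq (F := 𝓢(Rn n, ℂ)) f]
  rw [SchwartzMap.fourierInv_coe, Real.fourierInv_eq']
  refine integral_congr_ae (Filter.Eventually.of_forall fun s => ?_)
  simp only [smul_eq_mul]
  rw [mul_comm, inner_smul_left]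
  congr 2
  simp
  ring

/-- The inner integral of the Moyal product is `𝓕 g` times a character. Fourier inversion for `f`
turns what is left into the double integral that defines `𝓕⁻ (twistConv θ f g)`. -/
theorem moyal_eq_fourierInv (x : Rn n) : moyal θ f g x = 𝓕⁻ (twistConv θ f g) x := by
  set Y : Rn n → ℂ := fun t =>
    Complex.exp (Complex.I * ((inner ℝ ((2 * Real.pi) • t) x : ℝ) : ℂ)) with hYdef
  have hYadd : ∀ s r, Y (s + r) = Y s * Y r := fun s r => by
    simp only [hYdef]
    rw [← Complex.exp_add, smul_add, inner_add_left]
    push_cast; ring_nf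
  have hYnorm : ∀ t, ‖Y t‖ = 1 := fun t => by
    simp only [hYdef]
    rw [mul_comm, Complex.norm_exp_ofReal_mul_I]
  have hYc : Continuous Y := by
    simp only [hYdef]; fun_prop
  -- The factors `2π` convert the kernel `exp(2πi t·x)` of `𝓕⁻` into the kernel `exp(i s·x)`.
  have hR : 𝓕⁻ (twistConv θ f g) x = ∫ r, ∫ s, twistKernel θ f g s r • Y (s + r) := by
    have hint : Integrable (fun p : Rn n × Rn n => twistKernel θ f g p.2 p.1 • Y (p.2 + p.1))
        (volume.prod volume) := by
      have := (integrable_twistKernel θ f g).swap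
      refine this.norm.mono' (this.1.smul (hYc.comp
        (continuous_snd.add continuous_fst)).aestronglyMeasurable)
        (Filter.Eventually.of_forall fun p => ?_)
      rw [norm_smul, hYnorm, mul_one]
      exact le_rfl
    rw [integral_integral_swap hint,
      ← integral_twistConv_smul θ f g hYc (fun t => (hYnorm t).le), Real.fourierInv_eq']
    refine integral_congr_ae (Filter.Eventually.of_forall fun s => ?_)
    simp only [hYdef, smul_eq_mul]
    rw [mul_comm, inner_smul_left]
    congr 2
    simp
    ring
  rw [hR, moyal, ← smul_eq_mul, Complex.coe_smul, ← integral_comp_two_pi_smul]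
  refine integral_congr_ae (Filter.Eventually.of_forall fun r => ?_)
  have hf : ∫ s, twistKernel θ f g s r • Y (s + r) =
      𝓕 g r * Y r * f (x + (1 / 2 : ℝ) • mulVecE θ ((2 * Real.pi) • r)) := by
    rw [schwartz_fourier_inversion f, ← integral_const_mul]
    refine integral_congr_ae (Filter.Eventually.of_forall fun s => ?_)
    simp only [twistKernel, symp_eq_inner, smul_eq_mul, hYadd]
    have : Complex.exp (Complex.I * ((inner ℝ ((2 * Real.pi) • s)
        (x + (1 / 2 : ℝ) • mulVecE θ ((2 * Real.pi) • r)) : ℝ) : ℂ)) =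
        Y s * Complex.exp (Complex.I / 2 * ((inner ℝ ((2 * Real.pi) • s)
          (mulVecE θ ((2 * Real.pi) • r)) : ℝ) : ℂ)) := by
      simp only [hYdef]
      rw [← Complex.exp_add, inner_add_right, inner_smul_right _ (mulVecE θ _)]
      congr 1
      push_cast; ring
    rw [this]; ring
  have hg : ∫ t, g (x + t) *
      Complex.exp (-Complex.I * ((inner ℝ ((2 * Real.pi) • r) t : ℝ) : ℂ)) = 𝓕 g r * Y r := by
    have e : 𝓕 g r = ∫ y, g y *
        Complex.exp (-Complex.I * ((inner ℝ ((2 * Real.pi) • r) y : ℝ) : ℂ)) := by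
      rw [SchwartzMap.fourier_coe, Real.fourier_eq']
      refine integral_congr_ae (Filter.Eventually.of_forall fun y => ?_)
      simp only [smul_eq_mul]
      rw [mul_comm, inner_smul_left, real_inner_comm]
      congr 2
      simp
      ring
    rw [e, ← integral_mul_const, ← integral_add_left_eq_self (fun y => g y *
      Complex.exp (-Complex.I * ((inner ℝ ((2 * Real.pi) • r) y : ℝ) : ℂ)) * Y r) x]
    refine integral_congr_ae (Filter.Eventually.of_forall fun y => ?_)
    simp only [hYdef]
    rw [mul_assoc, ← Complex.exp_add, inner_add_right]
    congr 2
    push_cast; ring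
  dsimp only
  rw [hf, ← hg, mul_comm (∫ t, _), ← integral_const_mul]
  simp only [mul_assoc]

end Moyal

/-! ### Quantization -/

section Quantize

variable {n : ℕ} {θ : Matrix (Fin n) (Fin n) ℝ}
variable {H : Type*} [NormedAddCommGroup H] [InnerProductSpace ℂ H] [CompleteSpace H]
variable {u : Rn n → unitary (H →L[ℂ] H)}

theorem IsThetaRep.isHomothetyField (hu : IsThetaRep θ u) :
    IsHomothetyField (fun s => (u s : H →L[ℂ] H)) 1 :=
  ⟨hu.continuous_apply, fun s ξ => by rw [norm_unitary_apply, one_mul], zero_le_one⟩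

theorem IsThetaRep.mul_apply (hu : IsThetaRep θ u) (s t : Rn n) (ξ : H) :
    (u s : H →L[ℂ] H) ((u t : H →L[ℂ] H) ξ) =
      Complex.exp (Complex.I / 2 * (symp θ s t : ℝ)) • (u (s + t) : H →L[ℂ] H) ξ :=
  congrArg (fun T : H →L[ℂ] H => T ξ) (hu.mul_eq s t)

theorem IsThetaRep.apply_zero (hu : IsThetaRep θ u) : u 0 = 1 := by
  have h := hu.mul_eq 0 0
  have h0 : symp θ (0 : Rn n) 0 = 0 := by simp [symp]
  rw [h0, add_zero] at h
  simp only [Complex.ofReal_zero, mul_zero, Complex.exp_zero, one_smul] at h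
  have h' : u 0 * u 0 = u 0 := Subtype.ext h
  exact mul_eq_left.1 h'

theorem IsThetaRep.apply_neg (hu : IsThetaRep θ u) (hθ : θ.transpose = -θ) (s : Rn n) :
    u (-s) = star (u s) := by
  have h := hu.mul_eq s (-s)
  rw [symp_neg_right, symp_self hθ, add_neg_cancel, hu.apply_zero] at h
  simp only [neg_zero, Complex.ofReal_zero, mul_zero, Complex.exp_zero, one_smul] at h
  have h' : u s * u (-s) = 1 := Subtype.ext h
  rw [Unitary.star_eq_inv]
  exact (inv_eq_of_mul_eq_one_right h').symm

theorem IsThetaRep.continuous_scaled (hu : IsThetaRep θ u) (ξ : H) :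
    Continuous fun t : Rn n => (u ((2 * Real.pi) • t) : H →L[ℂ] H) ξ :=
  (hu.continuous_apply ξ).comp (continuous_const_smul _)

theorem IsThetaRep.integrable_smul (hu : IsThetaRep θ u) {k : Rn n → ℂ} (hk : Integrable k)
    (ξ : H) : Integrable fun t : Rn n => k t • (u ((2 * Real.pi) • t) : H →L[ℂ] H) ξ := by
  refine (hk.norm.mul_const ‖ξ‖).mono'
    (hk.1.smul (hu.continuous_scaled ξ).aestronglyMeasurable)
    (Filter.Eventually.of_forall fun t => ?_)
  rw [norm_smul, norm_unitary_apply]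

/-- The quantization in terms of the Fourier transform `𝓕` with kernel `exp(-2πi s·x)`. -/
theorem IsThetaRep.quantize_apply (hu : IsThetaRep θ u) (f : 𝓢(Rn n, ℂ)) (ξ : H) :
    hu.quantize f ξ = ∫ t, 𝓕 f t • (u ((2 * Real.pi) • t) : H →L[ℂ] H) ξ := by
  have h2 : (2 * Real.pi : ℝ) ≠ 0 := by positivity
  have h := integral_comp_two_pi_smul
    fun s : Rn n => (𝓕 f) ((2 * Real.pi)⁻¹ • s) • (u s : H →L[ℂ] H) ξ
  simp only [inv_smul_smul₀ h2] at h
  rw [h, ← integral_smul]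
  change ∫ s, fourierHat f s • (u s : H →L[ℂ] H) ξ = _
  simp only [fourierHat_eq, mul_smul, Complex.coe_smul]

theorem IsThetaRep.quantize_quantize (hu : IsThetaRep θ u) (f g : 𝓢(Rn n, ℂ)) (ξ : H) :
    hu.quantize f (hu.quantize g ξ) =
      ∫ t, twistConv θ f g t • (u ((2 * Real.pi) • t) : H →L[ℂ] H) ξ := by
  rw [integral_twistConv_smul θ f g (hu.continuous_scaled ξ)
    (fun t => (norm_unitary_apply _ ξ).le), hu.quantize_apply f]
  refine integral_congr_ae (Filter.Eventually.of_forall fun s => ?_)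
  dsimp only
  rw [hu.quantize_apply g, ← ContinuousLinearMap.integral_comp_comm _
    (hu.integrable_smul (𝓕 g).integrable ξ), ← integral_smul]
  refine integral_congr_ae (Filter.Eventually.of_forall fun r => ?_)
  simp only [map_smul, hu.mul_apply, smul_smul, twistKernel, smul_add, mul_assoc]

/-- The complex conjugate of a Schwartz function. -/
noncomputable def conjSchwartz (f : 𝓢(Rn n, ℂ)) : 𝓢(Rn n, ℂ) :=
  f.postcompCLM (Complex.conjCLE : ℂ →L[ℝ] ℂ)

theorem fourier_conjSchwartz (f : 𝓢(Rn n, ℂ)) (t : Rn n) :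
    𝓕 (conjSchwartz f) t = starRingEnd ℂ (𝓕 f (-t)) := by
  rw [SchwartzMap.fourier_coe, SchwartzMap.fourier_coe, Real.fourier_eq', Real.fourier_eq',
    ← integral_conj]
  refine integral_congr_ae (Filter.Eventually.of_forall fun x => ?_)
  simp only [smul_eq_mul, map_mul, ← Complex.exp_conj, Complex.conj_ofReal, Complex.conj_I]
  rw [show conjSchwartz f x = starRingEnd ℂ (f x) from rfl]
  congr 2
  simp

theorem IsThetaRep.star_quantize (hu : IsThetaRep θ u) (hθ : θ.transpose = -θ)
    (f : 𝓢(Rn n, ℂ)) : star (hu.quantize f) = hu.quantize (conjSchwartz f) := by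
  rw [ContinuousLinearMap.star_eq_adjoint]
  symm
  rw [ContinuousLinearMap.eq_adjoint_iff]
  intro ξ η
  rw [hu.quantize_apply f, hu.quantize_apply, ← inner_conj_symm,
    ← integral_inner (hu.integrable_smul (𝓕 (conjSchwartz f)).integrable ξ),
    ← integral_inner (hu.integrable_smul (𝓕 f).integrable η), ← integral_conj,
    ← integral_neg_eq_self]
  refine integral_congr_ae (Filter.Eventually.of_forall fun t => ?_)
  simp only
  rw [inner_conj_symm, fourier_conjSchwartz, neg_neg, smul_neg, hu.apply_neg hθ, inner_smul_left,
    inner_smul_right, Complex.conj_conj, Unitary.coe_star, ContinuousLinearMap.star_eq_adjoint,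
    ContinuousLinearMap.adjoint_inner_left]

/-- The quantizations of all Schwartz functions act nondegenerately on `H`. -/
theorem IsThetaRep.eq_zero_of_comp_quantize (hu : IsThetaRep θ u) (y : H →L[ℂ] H)
    (h : ∀ (g : 𝓢(Rn n, ℂ)) (η : H), y (hu.quantize g η) = 0) : y = 0 := by
  ext η
  have hc : Continuous fun t : Rn n => y ((u ((2 * Real.pi) • t) : H →L[ℂ] H) η) :=
    y.continuous.comp (hu.continuous_scaled η)
  have hae : ∀ᵐ t : Rn n, y ((u ((2 * Real.pi) • t) : H →L[ℂ] H) η) = 0 := by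
    refine ae_eq_zero_of_integral_contDiff_smul_eq_zero hc.locallyIntegrable fun g gs gc => ?_
    have hg₁ : HasCompactSupport (Complex.ofRealCLM ∘ g) := gc.comp_left rfl
    have hg₂ : ContDiff ℝ (⊤ : ℕ∞) (Complex.ofRealCLM ∘ g) := by fun_prop
    set φ : 𝓢(Rn n, ℂ) := hg₁.toSchwartzMap hg₂
    have hφ : ∀ x, φ x = (g x : ℂ) := fun x => rfl
    have := h (𝓕⁻ φ) η
    rw [hu.quantize_apply, FourierTransform.fourier_fourierInv_eq,
      ← ContinuousLinearMap.integral_comp_comm _ (hu.integrable_smul φ.integrable η)] at this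
    simp only [map_smul] at this
    simpa only [hφ, Complex.coe_smul] using this
  -- A continuous function that vanishes almost everywhere vanishes at `0`, where `u 0 = 1`.
  have hall := (hc.ae_eq_iff_eq volume continuous_const).1 hae
  have := congrFun hall 0
  simpa [hu.apply_zero] using this

end Quantize

/-! ### Ampliations -/

section Ampliation

variable {n : ℕ} {H : Type*} [NormedAddCommGroup H] [InnerProductSpace ℂ H]

variable (n H) in
/-- `L₂(ℝⁿ; H)`. -/
abbrev L2RnH : Type _ := Lp H 2 (volume : Measure (Rn n))

/-- The operator `1 ⊗ y` on `L₂(ℝⁿ; H) = L₂(ℝⁿ) ⊗ H`, acting by `y` pointwise. -/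
noncomputable def ampliation (n : ℕ) (y : H →L[ℂ] H) : L2RnH n H →L[ℂ] L2RnH n H :=
  y.compLpL 2 volume

theorem coeFn_ampliation (y : H →L[ℂ] H) (Ψ : L2RnH n H) :
    ampliation n y Ψ =ᵐ[volume] fun x => y (Ψ x) :=
  y.coeFn_compLpL Ψ

theorem ampliation_add (y z : H →L[ℂ] H) : ampliation n (y + z) = ampliation n y + ampliation n z :=
  ContinuousLinearMap.add_compLpL _ _

theorem ampliation_smul (c : ℂ) (y : H →L[ℂ] H) : ampliation n (c • y) = c • ampliation n y :=
  ContinuousLinearMap.smul_compLpL _ _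

theorem ampliation_zero : ampliation n (0 : H →L[ℂ] H) = 0 := by
  simpa using ampliation_smul (n := n) 0 (0 : H →L[ℂ] H)

theorem ampliation_mul (y z : H →L[ℂ] H) :
    ampliation n (y * z) = ampliation n y * ampliation n z := by
  ext1 Ψ
  refine Lp.ext ?_
  filter_upwards [coeFn_ampliation (y * z) Ψ, coeFn_ampliation y (ampliation n z Ψ),
    coeFn_ampliation z Ψ] with x h1 h2 h3
  rw [h1, mul_apply_eq_comp, mul_apply_eq_comp, h2, h3]

theorem ampliation_star [CompleteSpace H] (y : H →L[ℂ] H) :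
    ampliation n (star y) = star (ampliation n y) := by
  rw [ContinuousLinearMap.star_eq_adjoint, ContinuousLinearMap.star_eq_adjoint,
    ContinuousLinearMap.eq_adjoint_iff]
  intro Φ Ψ
  rw [L2.inner_def, L2.inner_def]
  refine integral_congr_ae ?_
  filter_upwards [coeFn_ampliation (n := n) (ContinuousLinearMap.adjoint y) Φ,
    coeFn_ampliation y Ψ] with x h1 h2
  rw [h1, h2, ContinuousLinearMap.adjoint_inner_left]

theorem continuous_ampliation : Continuous (ampliation n : (H →L[ℂ] H) → _) := by
  let L : (H →L[ℂ] H) →ₗ[ℂ] (L2RnH n H →L[ℂ] L2RnH n H) :=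
    { toFun := ampliation n, map_add' := ampliation_add, map_smul' := ampliation_smul }
  refine AddMonoidHomClass.continuous_of_bound L 1 fun y => ?_
  rw [one_mul]
  exact ContinuousLinearMap.norm_compLpL_le y

end Ampliation

/-! ### Intertwiners between Moyal multiplication and quantization -/

section Intertwiner

variable {n : ℕ} {θ : Matrix (Fin n) (Fin n) ℝ}
variable {H : Type*} [NormedAddCommGroup H] [InnerProductSpace ℂ H] [CompleteSpace H]
variable {u V : Rn n → unitary (H →L[ℂ] H)}

/-- The unitaries `V x` depend strongly continuously on `x` and implement the multiplication of
`u` by characters: `u s * V x = exp(i s·x) V x * u s`. -/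
structure ImplementsCharacters (u V : Rn n → unitary (H →L[ℂ] H)) : Prop where
  continuous_apply : ∀ ξ : H, Continuous fun x => (V x : H →L[ℂ] H) ξ
  apply_comm : ∀ (s x : Rn n) (ξ : H), (u s : H →L[ℂ] H) ((V x : H →L[ℂ] H) ξ) =
    Complex.exp (Complex.I * (inner ℝ s x : ℝ)) • (V x : H →L[ℂ] H) ((u s : H →L[ℂ] H) ξ)

theorem ImplementsCharacters.isHomothetyField (hV : ImplementsCharacters u V) :
    IsHomothetyField (fun x => (V x : H →L[ℂ] H)) 1 :=
  ⟨hV.continuous_apply, fun x ξ => by rw [norm_unitary_apply, one_mul], zero_le_one⟩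

theorem IsThetaRep.isHomothetyField_orbit (hu : IsThetaRep θ u) (ξ : H) :
    IsHomothetyField (fun t : Rn n => ContinuousLinearMap.toSpanSingleton ℂ
      ((u ((2 * Real.pi) • t) : H →L[ℂ] H) ξ)) ‖ξ‖ where
  continuous_apply c := by
    simp only [ContinuousLinearMap.toSpanSingleton_apply]
    exact (hu.continuous_scaled ξ).const_smul c
  norm_apply t c := by
    rw [ContinuousLinearMap.toSpanSingleton_apply, norm_smul, norm_unitary_apply, mul_comm]
  nonneg := norm_nonneg ξ

/-- The operator `L₂(ℝⁿ) → L₂(ℝⁿ; H)` that maps a Schwartz function `g` to the function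
`x ↦ u(g) V(x) ξ`. As `u(g) V(x) ξ = V(x) ∫ exp(2πi t·x) 𝓕 g(t) u(2πt) ξ dt`, it is composed of
Fourier transforms and multiplications by operator fields, which makes sense on all of `L₂`. -/
noncomputable def IsThetaRep.intertwiner (hu : IsThetaRep θ u)
    (hV : ImplementsCharacters u V) (ξ : H) : L2Rn n →L[ℂ] L2RnH n H :=
  hV.isHomothetyField.mulLp ∘L ((Lp.fourierTransformₗᵢ (Rn n) H).symm.toContinuousLinearEquiv :
      L2RnH n H →L[ℂ] L2RnH n H) ∘L
    (hu.isHomothetyField_orbit ξ).mulLp ∘L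
    ((Lp.fourierTransformₗᵢ (Rn n) ℂ).toContinuousLinearEquiv : L2Rn n →L[ℂ] L2Rn n)

variable (hu : IsThetaRep θ u) (hV : ImplementsCharacters u V)

theorem IsThetaRep.intertwiner_apply (ξ : H) (g : L2Rn n) :
    hu.intertwiner hV ξ g =
      hV.isHomothetyField.mulLp (𝓕⁻ ((hu.isHomothetyField_orbit ξ).mulLp (𝓕 g)) : L2RnH n H) := rfl

theorem IsThetaRep.norm_intertwiner (ξ : H) (g : L2Rn n) :
    ‖hu.intertwiner hV ξ g‖ = ‖ξ‖ * ‖g‖ := by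
  have h : ∀ Ψ : L2RnH n H, ‖(𝓕⁻ Ψ : L2RnH n H)‖ = ‖Ψ‖ :=
    (Lp.fourierTransformₗᵢ (Rn n) H).symm.norm_map
  rw [hu.intertwiner_apply, hV.isHomothetyField.norm_mulLp, h, IsHomothetyField.norm_mulLp, Lp.norm_fourier_eq,
    one_mul]

/-- The defining formula of the intertwiner becomes a pointwise integral for functions whose
Fourier transform is integrable. -/
theorem IsThetaRep.intertwiner_of_fourier {k : Rn n → ℂ} (hk : Integrable k) {g : L2Rn n}
    (hg : (𝓕 g : L2Rn n) =ᵐ[volume] k) (ξ : H) : hu.intertwiner hV ξ g =ᵐ[volume]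
      fun x => ∫ t, k t • (u ((2 * Real.pi) • t) : H →L[ℂ] H) ((V x : H →L[ℂ] H) ξ) := by
  have hi := hu.integrable_smul hk ξ
  have hm : MemLp (fun t => k t • (u ((2 * Real.pi) • t) : H →L[ℂ] H) ξ) 2 :=
    (hu.isHomothetyField_orbit ξ).memLp ((memLp_congr_ae hg).1 (Lp.memLp _))
  have e : (hu.isHomothetyField_orbit ξ).mulLp (𝓕 g) = hm.toLp _ := by
    refine Lp.ext ?_
    filter_upwards [(hu.isHomothetyField_orbit ξ).coeFn_mulLp (𝓕 g), hm.coeFn_toLp, hg]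
      with t e1 e2 e3
    rw [e1, e2, e3, ContinuousLinearMap.toSpanSingleton_apply]
  rw [hu.intertwiner_apply, e]
  filter_upwards [hV.isHomothetyField.coeFn_mulLp (𝓕⁻ (hm.toLp _) : L2RnH n H),
    coeFn_fourierInv_toLp hi hm] with x e1 e2
  have hi' : Integrable fun t => Complex.exp (((2 * Real.pi * inner ℝ t x : ℝ) : ℂ) * Complex.I) •
      k t • (u ((2 * Real.pi) • t) : H →L[ℂ] H) ξ := by
    refine hi.norm.mono' ((Continuous.aestronglyMeasurable (by fun_prop)).smul hi.1)
      (Filter.Eventually.of_forall fun t => ?_)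
    rw [norm_smul, Complex.norm_exp_ofReal_mul_I, one_mul]
  rw [e1, e2, Real.fourierInv_eq', ← ContinuousLinearMap.integral_comp_comm _ hi']
  refine integral_congr_ae (Filter.Eventually.of_forall fun t => ?_)
  simp only [map_smul]
  rw [hV.apply_comm, smul_comm, inner_smul_left, mul_comm Complex.I]
  simp

theorem IsThetaRep.intertwiner_toLp (g : 𝓢(Rn n, ℂ)) (ξ : H) :
    hu.intertwiner hV ξ (g.toLp 2 volume) =ᵐ[volume]
      fun x => hu.quantize g ((V x : H →L[ℂ] H) ξ) := by
  have hg : (𝓕 (g.toLp 2 volume) : L2Rn n) =ᵐ[volume] (𝓕 g : 𝓢(Rn n, ℂ)) := by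
    rw [SchwartzMap.toLp_fourier_eq]
    exact (𝓕 g).coeFn_toLp 2 volume
  filter_upwards [hu.intertwiner_of_fourier hV (𝓕 g).integrable hg ξ] with x hx
  rw [hx, hu.quantize_apply]

/-- The Moyal product `f ⋆_θ g` is square integrable, and the intertwiners carry `g ↦ f ⋆_θ g` to
`1 ⊗ u(f)`. -/
theorem IsThetaRep.exists_intertwiner_moyal (f g : 𝓢(Rn n, ℂ)) :
    ∃ m : L2Rn n, m =ᵐ[volume] moyal θ f g ∧ ∀ ξ, hu.intertwiner hV ξ m =
      ampliation n (hu.quantize f) (hu.intertwiner hV ξ (g.toLp 2 volume)) := by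
  have h1 := integrable_twistConv θ f g
  have h2 := memLp_twistConv θ f g
  refine ⟨𝓕⁻ (h2.toLp _), ?_, fun ξ => ?_⟩
  · filter_upwards [coeFn_fourierInv_toLp h1 h2] with x hx
    rw [hx, moyal_eq_fourierInv]
  · have hg : (𝓕 (𝓕⁻ (h2.toLp _) : L2Rn n) : L2Rn n) =ᵐ[volume] twistConv θ f g := by
      rw [FourierTransform.fourier_fourierInv_eq]
      exact h2.coeFn_toLp
    refine Lp.ext ?_
    filter_upwards [hu.intertwiner_of_fourier hV h1 hg ξ,
      hu.intertwiner_toLp hV g ξ, coeFn_ampliation (hu.quantize f)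
        (hu.intertwiner hV ξ (g.toLp 2 volume))] with x e1 e2 e3
    rw [e1, e3, e2, hu.quantize_quantize]

/-- The ranges of the intertwiners separate the operators on `H`: on Schwartz functions the
hypothesis reads `y u(g) V(x) ξ = 0` for almost every `x`, hence for every `x` by continuity. -/
theorem IsThetaRep.eq_zero_of_ampliation_intertwiner (y : H →L[ℂ] H)
    (h : ∀ ξ g, ampliation n y (hu.intertwiner hV ξ g) = 0) : y = 0 := by
  refine hu.eq_zero_of_comp_quantize y fun g η => ?_
  set ξ : H := (star (V 0) : unitary (H →L[ℂ] H)).1 η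
  have hξ : (V 0 : H →L[ℂ] H) ξ = η := by
    have := Unitary.mul_star_self_of_mem (V 0).2
    exact congrArg (fun T : H →L[ℂ] H => T η) this
  have hc : Continuous fun x => y (hu.quantize g ((V x : H →L[ℂ] H) ξ)) :=
    y.continuous.comp ((hu.quantize g).continuous.comp (hV.continuous_apply ξ))
  have hae : (fun x => y (hu.quantize g ((V x : H →L[ℂ] H) ξ))) =ᵐ[volume] fun _ => (0 : H) := by
    have h0 := h ξ (g.toLp 2 volume)
    filter_upwards [hu.intertwiner_toLp hV g ξ, coeFn_ampliation y
      (hu.intertwiner hV ξ (g.toLp 2 volume)), (Lp.eq_zero_iff_ae_eq_zero.1 h0)] with x e1 e2 e3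
    rw [← e1, ← e2, e3, Pi.zero_apply]
  have := congrFun ((hc.ae_eq_iff_eq volume continuous_const).1 hae) 0
  rwa [hξ] at this

end Intertwiner

/-! ### Canonical representations -/

section Canonical

variable {n : ℕ} {θ : Matrix (Fin n) (Fin n) ℝ}
variable {H : Type*} [NormedAddCommGroup H] [InnerProductSpace ℂ H] [CompleteSpace H]
variable {u V : Rn n → unitary (H →L[ℂ] H)}
variable (hu : IsThetaRep θ u) (hV : ImplementsCharacters u V)

theorem IsLeftMoyal.unique {f : 𝓢(Rn n, ℂ)} {T T' : L2Rn n →L[ℂ] L2Rn n}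
    (hT : IsLeftMoyal θ f T) (hT' : IsLeftMoyal θ f T') : T = T' := by
  refine ContinuousLinearMap.coeFn_injective ?_
  refine (SchwartzMap.denseRange_toLpCLM (E := Rn n) (F := ℂ) (p := 2) (μ := volume)
    ENNReal.ofNat_ne_top).equalizer T.continuous T'.continuous (funext fun g => ?_)
  exact Lp.ext ((hT g).trans (hT' g).symm)

/-- The pairs `(x, y)` of operators on `L₂(ℝⁿ)` and `H` such that all intertwiners carry `x` to
`1 ⊗ y` and `x⋆` to `1 ⊗ y⋆`. -/
noncomputable def IsThetaRep.intertwinedPairs :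
    NonUnitalStarSubalgebra ℂ ((L2Rn n →L[ℂ] L2Rn n) × (H →L[ℂ] H)) where
  carrier := {p | ∀ ξ g, hu.intertwiner hV ξ (p.1 g) = ampliation n p.2 (hu.intertwiner hV ξ g) ∧
    hu.intertwiner hV ξ (star p.1 g) = ampliation n (star p.2) (hu.intertwiner hV ξ g)}
  zero_mem' := fun ξ g => by simp [ampliation_zero]
  add_mem' := fun {p q} hp hq ξ g => by
    constructor
    · simp [ampliation_add, (hp ξ g).1, (hq ξ g).1]
    · simp [ampliation_add, (hp ξ g).2, (hq ξ g).2]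
  smul_mem' := fun c p hp ξ g => by
    constructor
    · simp [ampliation_smul, (hp ξ g).1]
    · simp [ampliation_smul, (hp ξ g).2]
  mul_mem' := fun {p q} hp hq ξ g => by
    constructor
    · simp [ampliation_mul, (hp ξ (q.1 g)).1, (hq ξ g).1]
    · simp [ampliation_mul, (hp ξ g).2, (hq ξ (star p.1 g)).2]
  star_mem' := fun {p} hp ξ g => ⟨(hp ξ g).2, by simpa using (hp ξ g).1⟩

theorem IsThetaRep.mem_intertwinedPairs {p : (L2Rn n →L[ℂ] L2Rn n) × (H →L[ℂ] H)} :
    p ∈ hu.intertwinedPairs hV ↔ ∀ ξ g,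
      hu.intertwiner hV ξ (p.1 g) = ampliation n p.2 (hu.intertwiner hV ξ g) ∧
      hu.intertwiner hV ξ (star p.1 g) = ampliation n (star p.2) (hu.intertwiner hV ξ g) :=
  Iff.rfl

theorem IsThetaRep.isClosed_intertwinedPairs :
    IsClosed (hu.intertwinedPairs hV : Set ((L2Rn n →L[ℂ] L2Rn n) × (H →L[ℂ] H))) := by
  have h1 : ∀ g : L2Rn n, Continuous fun T : L2Rn n →L[ℂ] L2Rn n => T g := fun g =>
    (ContinuousLinearMap.apply ℂ _ g).continuous
  have h2 : ∀ Ψ : L2RnH n H, Continuous fun y : H →L[ℂ] H => ampliation n y Ψ := fun Ψ =>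
    (ContinuousLinearMap.apply ℂ _ Ψ).continuous.comp continuous_ampliation
  have hset : (hu.intertwinedPairs hV : Set ((L2Rn n →L[ℂ] L2Rn n) × (H →L[ℂ] H))) =
      ⋂ ξ, ⋂ g, {p | hu.intertwiner hV ξ (p.1 g) = ampliation n p.2 (hu.intertwiner hV ξ g)} ∩
        {p : (L2Rn n →L[ℂ] L2Rn n) × (H →L[ℂ] H) | hu.intertwiner hV ξ (star p.1 g) =
            ampliation n (star p.2) (hu.intertwiner hV ξ g)} := by
    ext p
    simp only [Set.mem_iInter]
    rfl
  rw [hset]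
  refine isClosed_iInter fun ξ => isClosed_iInter fun g => IsClosed.inter ?_ ?_
  · exact isClosed_eq ((hu.intertwiner hV ξ).continuous.comp ((h1 g).comp continuous_fst))
      ((h2 _).comp continuous_snd)
  · exact isClosed_eq
      ((hu.intertwiner hV ξ).continuous.comp ((h1 g).comp continuous_fst.star))
      ((h2 _).comp continuous_snd.star)

/-- Left Moyal multiplication by `f`, obtained by compressing `1 ⊗ u(f)` along the intertwiner
of a unit vector `ξ`. -/
noncomputable def IsThetaRep.leftMoyal (ξ : H) (f : 𝓢(Rn n, ℂ)) : L2Rn n →L[ℂ] L2Rn n :=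
  ContinuousLinearMap.adjoint (hu.intertwiner hV ξ) ∘L ampliation n (hu.quantize f) ∘L
    hu.intertwiner hV ξ

theorem IsThetaRep.isLeftMoyal_leftMoyal {ξ : H} (hξ : ‖ξ‖ = 1) (f : 𝓢(Rn n, ℂ)) :
    IsLeftMoyal θ f (hu.leftMoyal hV ξ f) := by
  intro g
  obtain ⟨m, hm, hJ⟩ := hu.exists_intertwiner_moyal hV f g
  have h1 : ContinuousLinearMap.adjoint (hu.intertwiner hV ξ) ∘L hu.intertwiner hV ξ = 1 :=
    (ContinuousLinearMap.norm_map_iff_adjoint_comp_self _).1 fun g => by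
      rw [hu.norm_intertwiner, hξ, one_mul]
  have h2 : hu.leftMoyal hV ξ f (g.toLp 2 volume) = m := by
    rw [leftMoyal, ContinuousLinearMap.comp_apply, ContinuousLinearMap.comp_apply, ← hJ]
    exact congrArg (fun T : L2Rn n →L[ℂ] L2Rn n => T m) h1
  rw [h2]
  exact hm

theorem IsLeftMoyal.intertwiner_apply {f : 𝓢(Rn n, ℂ)} {T : L2Rn n →L[ℂ] L2Rn n}
    (hT : IsLeftMoyal θ f T) (ξ : H) (g : L2Rn n) :
    hu.intertwiner hV ξ (T g) = ampliation n (hu.quantize f) (hu.intertwiner hV ξ g) := by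
  have h := (SchwartzMap.denseRange_toLpCLM (E := Rn n) (F := ℂ) (p := 2) (μ := volume)
    ENNReal.ofNat_ne_top).equalizer ((hu.intertwiner hV ξ).continuous.comp T.continuous)
    ((ampliation n (hu.quantize f)).continuous.comp (hu.intertwiner hV ξ).continuous)
    (funext fun g => ?_)
  · exact congrFun h g
  · obtain ⟨m, hm, hJ⟩ := hu.exists_intertwiner_moyal hV f g
    have : T (g.toLp 2 volume) = m := Lp.ext ((hT g).trans hm.symm)
    exact (congrArg (hu.intertwiner hV ξ) this).trans (hJ ξ)

theorem IsThetaRep.star_leftMoyal (hθ : θ.transpose = -θ) (ξ : H) (f : 𝓢(Rn n, ℂ)) :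
    star (hu.leftMoyal hV ξ f) = hu.leftMoyal hV ξ (conjSchwartz f) := by
  rw [leftMoyal, leftMoyal, ← hu.star_quantize hθ, ampliation_star,
    ContinuousLinearMap.star_eq_adjoint, ContinuousLinearMap.star_eq_adjoint,
    ContinuousLinearMap.adjoint_comp, ContinuousLinearMap.adjoint_comp,
    ContinuousLinearMap.adjoint_adjoint, ContinuousLinearMap.comp_assoc]

/-- A `θ`-representation is canonical as soon as its products with all characters are unitarily
equivalent to it, by unitaries that depend strongly continuously on the character. -/
theorem IsThetaRep.isCanonical [Nontrivial H] (hθ : θ.transpose = -θ)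
    (hV : ImplementsCharacters u V) : hu.IsCanonical := by
  obtain ⟨ξ₀, hξ₀⟩ := exists_norm_eq H zero_le_one
  have hL := fun f => hu.isLeftMoyal_leftMoyal hV hξ₀ f
  refine ⟨fun f => ⟨_, hL f⟩, ?_⟩
  have hrange : Set.range (hu.leftMoyal hV ξ₀) = {T | ∃ f : 𝓢(Rn n, ℂ), IsLeftMoyal θ f T} :=
    Set.ext fun T =>
      ⟨fun ⟨f, hf⟩ => ⟨f, hf ▸ hL f⟩, fun ⟨f, hf⟩ => ⟨f, (hL f).unique hf⟩⟩
  have hmem : ∀ f, (hu.leftMoyal hV ξ₀ f, hu.quantize f) ∈ hu.intertwinedPairs hV := by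
    intro f ξ g
    refine ⟨(hL f).intertwiner_apply hu hV ξ g, ?_⟩
    dsimp only
    rw [hu.star_leftMoyal hV hθ, hu.star_quantize hθ]
    exact (hL (conjSchwartz f)).intertwiner_apply hu hV ξ g
  have hzero : ∀ p ∈ hu.intertwinedPairs hV, p.1 = 0 ↔ p.2 = 0 := by
    rintro ⟨x, y⟩ hp
    rw [hu.mem_intertwinedPairs] at hp
    dsimp only at hp ⊢
    constructor
    · rintro rfl
      refine hu.eq_zero_of_ampliation_intertwiner hV y fun ξ g => ?_
      rw [← (hp ξ g).1, zero_apply, map_zero]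
    · rintro rfl
      ext1 g
      have h := hu.norm_intertwiner hV ξ₀ (x g)
      rw [(hp ξ₀ g).1, ampliation_zero, zero_apply, norm_zero, hξ₀, one_mul] at h
      exact norm_eq_zero.1 h.symm
  obtain ⟨e, he⟩ := exists_starAlgEquiv_of_graph (hu.leftMoyal hV ξ₀) hu.quantize hrange rfl
    (hu.intertwinedPairs hV) (hu.isClosed_intertwinedPairs hV) hmem hzero
  exact ⟨e, fun f T hT => he f T (hT.unique (hL f))⟩

end Canonical

/-! ### Restriction to a hyperplane -/

section Hat

variable {n : ℕ}

theorem appendZero_castSucc (s : Rn n) (j : Fin n) : appendZero s j.castSucc = s j := by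
  simp [appendZero]

theorem appendZero_last (s : Rn n) : appendZero s (Fin.last n) = 0 := by
  simp [appendZero]

theorem appendZero_add (s t : Rn n) : appendZero (s + t) = appendZero s + appendZero t := by
  ext j
  refine Fin.lastCases ?_ (fun j => ?_) j
  · simp [appendZero_last]
  · simp [appendZero_castSucc]

theorem continuous_appendZero : Continuous (appendZero : Rn n → Rn (n + 1)) := by
  refine (PiLp.continuous_toLp 2 _).comp (continuous_pi fun j => ?_)
  refine Fin.lastCases ?_ (fun j => ?_) j
  · simpa using continuous_const
  · simp only [Fin.snoc_castSucc]
    fun_prop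

theorem inner_appendZero (s t : Rn n) :
    inner ℝ (appendZero s) (appendZero t) = inner ℝ s t := by
  simp [PiLp.inner_apply, Fin.sum_univ_castSucc, appendZero_castSucc, appendZero_last]

theorem symp_hatMatrix (θ : Matrix (Fin (n + 1)) (Fin (n + 1)) ℝ) (s t : Rn n) :
    symp (hatMatrix θ) s t = symp θ (appendZero s) (appendZero t) := by
  simp [symp, Fin.sum_univ_castSucc, appendZero_castSucc, appendZero_last, hatMatrix]

theorem hatMatrix_transpose {θ : Matrix (Fin (n + 1)) (Fin (n + 1)) ℝ}
    (hskew : θ.transpose = -θ) : (hatMatrix θ).transpose = -hatMatrix θ := by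
  rw [hatMatrix, Matrix.transpose_submatrix, hskew, Matrix.submatrix_neg]
  rfl

variable {H : Type*} [NormedAddCommGroup H] [InnerProductSpace ℂ H] [CompleteSpace H]

theorem IsThetaRep.apply_apply_swap {θ : Matrix (Fin n) (Fin n) ℝ}
    {u : Rn n → unitary (H →L[ℂ] H)}
    (hu : IsThetaRep θ u) (hskew : θ.transpose = -θ) (s t : Rn n) (ξ : H) :
    (u s : H →L[ℂ] H) ((u t : H →L[ℂ] H) ξ) =
      Complex.exp (Complex.I * (symp θ s t : ℝ)) • (u t : H →L[ℂ] H) ((u s : H →L[ℂ] H) ξ) := by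
  rw [hu.mul_apply, hu.mul_apply, smul_smul, ← Complex.exp_add, add_comm t s,
    symp_swap hskew t s]
  congr 2
  push_cast; ring

theorem IsThetaRep.hat {θ : Matrix (Fin (n + 1)) (Fin (n + 1)) ℝ}
    {u : Rn (n + 1) → unitary (H →L[ℂ] H)} (hu : IsThetaRep θ u) :
    IsThetaRep (hatMatrix θ) (fun s : Rn n => u (appendZero s)) where
  continuous_apply ξ := (hu.continuous_apply ξ).comp continuous_appendZero
  mul_eq s t := by rw [hu.mul_eq, symp_hatMatrix, appendZero_add]

/-- As `θ` is nonsingular, every character of the hyperplane has the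
form `s ↦ exp(i θ((s, 0), y))`, and `y = θ⁻¹ (x, 0)` gives the character `s ↦ exp(i s·x)`. -/
theorem IsThetaRep.implementsCharacters {θ : Matrix (Fin (n + 1)) (Fin (n + 1)) ℝ}
    (hskew : θ.transpose = -θ) (hns : IsUnit θ.det) {u : Rn (n + 1) → unitary (H →L[ℂ] H)}
    (hu : IsThetaRep θ u) : ImplementsCharacters (fun s : Rn n => u (appendZero s))
      (fun x => u (mulVecE θ⁻¹ (appendZero x))) where
  continuous_apply ξ :=
    (hu.continuous_apply ξ).comp ((continuous_mulVecE _).comp continuous_appendZero)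
  apply_comm s x ξ := by
    have h : mulVecE θ (mulVecE θ⁻¹ (appendZero x)) = appendZero x := by
      simp [mulVecE, Matrix.mulVec_mulVec, Matrix.mul_nonsing_inv θ hns]
    rw [hu.apply_apply_swap hskew, symp_eq_inner, h, inner_appendZero]

end Hat

theorem lemma3 {n : ℕ} (θ : Matrix (Fin (n + 1)) (Fin (n + 1)) ℝ)
    (hskew : θ.transpose = -θ) (hns : IsUnit θ.det)
    {H : Type*} [NormedAddCommGroup H] [InnerProductSpace ℂ H] [CompleteSpace H] [Nontrivial H]
    (u : Rn (n + 1) → unitary (H →L[ℂ] H)) (hu : IsThetaRep θ u) :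
    ∃ huhat : IsThetaRep (hatMatrix θ) (fun s : Rn n => u (appendZero s)),
      huhat.IsCanonical :=
  ⟨hu.hat, hu.hat.isCanonical (hatMatrix_transpose hskew)
    (hu.implementsCharacters hskew hns)⟩
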